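/- Let $q$ be a prime power and let $\mathbb{F}_q$ be the finite field of order $q$. For positive integers $n, k, m$ with $k \le n$ and $m \le q^k$, call a set $S \subseteq \mathbb{F}_q^n$ a $(k,m)$-Furstenberg set if for every $k$-dimensional linear subspace $W$ of $\mathbb{F}_q^n$ there is a translate of $W$ that contains at least $m$ points of $S$, and let $K(q,n,k,m)$ be the least $t$ such that there is a $(k,m)$-Furstenberg set of cardinality $t$ in $\mathbb{F}_q^n$. **Theorem.** Let $q$ be a prime power, and let $n, k, m$ be positive integers such that $m \le q^k$ and $k$ divides $n$. Then $$K(q,n,k,m) \;\ge\; \frac{1}{2^{n/k}}\, m^{n/k}.$$ -/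

import Mathlib

open scoped Pointwise

/-- A set `S` of points of `F ^ n` is a `(k, m)`-Furstenberg set if every linear subspace `W`
of dimension `k` has a translate `v + W` that meets `S` in at least `m` points. -/
def IsFurstenberg {F : Type*} [Field F] {n : ℕ} (k m : ℕ) (S : Finset (Fin n → F)) : Prop :=
  ∀ W : Submodule F (Fin n → F), Module.finrank F W = k →
    ∃ v : Fin n → F, m ≤ ((v +ᵥ (W : Set (Fin n → F))) ∩ (S : Set (Fin n → F))).ncard

/-- `K(q, n, k, m)`, where `q` is the order of the finite field `F`: the least `t` such that
there is a `(k, m)`-Furstenberg set in `F ^ n` of cardinality `t`. -/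
noncomputable def furstenbergNumber (F : Type*) [Field F] (n k m : ℕ) : ℕ :=
  sInf {t : ℕ | ∃ S : Finset (Fin n → F), IsFurstenberg k m S ∧ S.card = t}

/-- The minimum defining `furstenbergNumber` is over a nonempty set, so it is attained. -/
theorem exists_isFurstenberg_card_eq (F : Type*) [Field F] [Finite F] (n k m : ℕ)
    (hm : m ≤ Nat.card F ^ k) :
    ∃ S : Finset (Fin n → F), IsFurstenberg k m S ∧ S.card = furstenbergNumber F n k m := by
  classical
  have := Fintype.ofFinite F
  refine Nat.sInf_mem (s := {t : ℕ | ∃ S : Finset (Fin n → F), IsFurstenberg k m S ∧ S.card = t})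
    ⟨_, Finset.univ, ?_, rfl⟩
  intro W hW
  refine ⟨0, ?_⟩
  have h : Nat.card W = Nat.card F ^ k := by
    rw [Module.natCard_eq_pow_finrank (K := F), hW]
  have h' : (W : Set (Fin n → F)).ncard = Nat.card W := rfl
  rw [zero_vadd, Finset.coe_univ, Set.inter_univ, h', h]
  exact hm

/-! Let `E` be the extension of `F` of degree `k`, of order `Q`, and let `d = n / k`. An `F`-linear
identification of `F^n` with `E^d` turns each `E`-line through 0 into a `k`-dimensional
`F`-subspace, so `S` becomes a set `K` with at least `m` points on some line in every direction.

Such sets are bounded by the method of multiplicities. If `K` is small, some `P ≠ 0` of degree below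
`m r Q` vanishes to order `2 Q r` on `K` (`exists_ne_zero_mem_ptIdeal_pow`). Restricting to the rich
lines makes the top form of `P` vanish to order `m r` at every direction
(`coeff_expand_homogeneousComponent_eq_zero`). Schwartz-Zippel with multiplicities
(`card_mul_sum_mult_le`) then forces degree at least `m r Q`, a contradiction. Letting `r → ∞`
leaves `m^d ≤ |K| 2^d`. -/

namespace Furstenberg

/-! ### Vanishing orders and expansions along a parameter. -/

section Multiplicity

variable {E : Type*} [Field E] {σ : Type*}

/-- The maximal ideal of polynomials vanishing at the point `a`. -/
noncomputable def ptIdeal (a : σ → E) : Ideal (MvPolynomial σ E) :=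
  Ideal.span (Set.range fun i => MvPolynomial.X i - MvPolynomial.C (a i))

/-- The polynomial `P (a + s Y)`, as a polynomial in `s` over `E[Y]`. -/
noncomputable def expand (a : σ → E) :
    MvPolynomial σ E →ₐ[E] Polynomial (MvPolynomial σ E) :=
  MvPolynomial.aeval fun i => Polynomial.C (MvPolynomial.C (a i)) +
    Polynomial.X * Polynomial.C (MvPolynomial.X i)

/-- The polynomial `P (Y + a)`. -/
noncomputable def translate (a : σ → E) : MvPolynomial σ E →ₐ[E] MvPolynomial σ E :=
  MvPolynomial.aeval fun i => MvPolynomial.X i + MvPolynomial.C (a i)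

theorem translate_neg_translate (a : σ → E) (P : MvPolynomial σ E) :
    translate (-a) (translate a P) = P := by
  have h : (translate (-a)).comp (translate a) = AlgHom.id E _ := by
    ext1 i
    simp [translate]
  exact DFunLike.congr_fun h P

theorem map_mem_pow_of_mem_ptIdeal_pow {A : Type*} [CommRing A] [Algebra E A]
    (φ : MvPolynomial σ E →ₐ[E] A) {a : σ → E} {J : Ideal A}
    (h : ∀ i, φ (MvPolynomial.X i) - algebraMap E A (a i) ∈ J) {M : ℕ} {P : MvPolynomial σ E}
    (hP : P ∈ ptIdeal a ^ M) : φ P ∈ J ^ M := by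
  have h1 : (ptIdeal a).map φ ≤ J := by
    rw [ptIdeal, Ideal.map_span, Ideal.span_le]
    rintro _ ⟨_, ⟨i, rfl⟩, rfl⟩
    have := h i
    rw [← φ.commutes] at this
    simpa [MvPolynomial.algebraMap_eq] using this
  have h2 := Ideal.mem_map_of_mem φ hP
  rw [Ideal.map_pow] at h2
  exact Ideal.pow_right_mono h1 M h2

theorem mem_ptIdeal_pow_iff_translate (a : σ → E) (M : ℕ) (P : MvPolynomial σ E) :
    P ∈ ptIdeal a ^ M ↔ translate a P ∈ MvPolynomial.idealOfVars σ E ^ M := by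
  constructor
  · intro h
    refine map_mem_pow_of_mem_ptIdeal_pow _ (fun i => ?_) h
    have : translate a (MvPolynomial.X i) - algebraMap E (MvPolynomial σ E) (a i)
        = MvPolynomial.X i := by simp [translate, MvPolynomial.algebraMap_eq]
    rw [this]
    exact Ideal.subset_span ⟨i, rfl⟩
  · intro h
    have h0 : MvPolynomial.idealOfVars σ E = ptIdeal 0 := by simp [ptIdeal]
    rw [h0] at h
    have := map_mem_pow_of_mem_ptIdeal_pow (translate (-a)) (J := ptIdeal a) (fun i => ?_) h
    · rwa [translate_neg_translate] at this
    · exact Ideal.subset_span ⟨i, by simp [translate, sub_eq_add_neg]⟩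

theorem expand_zero_monomial (e : σ →₀ ℕ) (c : E) :
    expand 0 (MvPolynomial.monomial e c) =
      Polynomial.C (MvPolynomial.monomial e c) * Polynomial.X ^ e.degree := by
  induction e using Finsupp.induction_linear generalizing c with
  | zero =>
    have : expand (σ := σ) (0 : σ → E) (MvPolynomial.C c) =
      Polynomial.C (MvPolynomial.C c) := by
        rw [← MvPolynomial.algebraMap_eq, AlgHom.commutes]; rfl
    simp [this]
  | add f g hf hg =>
    have : MvPolynomial.monomial (f + g) c =
        MvPolynomial.monomial f c * MvPolynomial.monomial g 1 := by
      simp [MvPolynomial.monomial_mul]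
    rw [this, map_mul, hf, hg, map_add, map_mul, pow_add]
    ring
  | single i n =>
    have : (MvPolynomial.monomial (Finsupp.single i n)) c =
        MvPolynomial.C c * MvPolynomial.X i ^ n := by
      rw [MvPolynomial.X_pow_eq_monomial, MvPolynomial.C_mul_monomial, mul_one]
    have hC : expand (σ := σ) (0 : σ → E) (MvPolynomial.C c) =
      Polynomial.C (MvPolynomial.C c) := by
        rw [← MvPolynomial.algebraMap_eq, AlgHom.commutes]; rfl
    rw [this, map_mul, hC, map_pow]
    simp [expand, Finsupp.degree_single]
    ring

theorem coeff_expand_zero (P : MvPolynomial σ E) (w : ℕ) (e : σ →₀ ℕ) (he : e.degree = w) :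
    ((expand 0 P).coeff w).coeff e = P.coeff e := by
  classical
  induction P using MvPolynomial.induction_on' with
  | add p q hp hq => simp [hp, hq]
  | monomial u c =>
    rw [expand_zero_monomial, Polynomial.coeff_C_mul, Polynomial.coeff_X_pow]
    by_cases h : u = e
    · simp [h, he]
    · split_ifs <;> simp [h]

theorem expand_eq_expand_zero_translate (a : σ → E) (P : MvPolynomial σ E) :
    expand a P = expand 0 (translate a P) := by
  have h : expand a = (expand 0).comp (translate a) := by
    ext1 i
    have hC : expand (σ := σ) (0 : σ → E) (MvPolynomial.C (a i)) =
      Polynomial.C (MvPolynomial.C (a i)) := by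
        rw [← MvPolynomial.algebraMap_eq, AlgHom.commutes]; rfl
    have hX : expand (σ := σ) (0 : σ → E) (MvPolynomial.X i) =
      Polynomial.X * Polynomial.C (MvPolynomial.X i) := by simp [expand]
    rw [AlgHom.comp_apply]
    conv_rhs => rw [translate, MvPolynomial.aeval_X, map_add, hC, hX]
    simp [expand, add_comm]
  rw [h]; rfl

/-- After translating `a` to the origin, the coefficient of `s ^ w` in the expansion is the
homogeneous part of degree `w`. -/
theorem mem_ptIdeal_pow_iff (a : σ → E) (M : ℕ) (P : MvPolynomial σ E) :
    P ∈ ptIdeal a ^ M ↔ Polynomial.X ^ M ∣ expand a P := by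
  constructor
  · intro h
    rw [← Ideal.mem_span_singleton, ← Ideal.span_singleton_pow]
    refine map_mem_pow_of_mem_ptIdeal_pow _ (fun i => ?_) h
    rw [Ideal.mem_span_singleton]
    refine ⟨Polynomial.C (MvPolynomial.X i), ?_⟩
    rw [sub_eq_iff_eq_add']
    simp [expand]
  · intro h
    rw [mem_ptIdeal_pow_iff_translate, MvPolynomial.mem_pow_idealOfVars_iff']
    intro e he
    rw [← coeff_expand_zero _ _ e rfl, ← expand_eq_expand_zero_translate,
      Polynomial.X_pow_dvd_iff.1 h _ he, MvPolynomial.coeff_zero]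

theorem expand_ne_zero (a : σ → E) {P : MvPolynomial σ E} (hP : P ≠ 0) : expand a P ≠ 0 := by
  intro h
  rw [expand_eq_expand_zero_translate] at h
  have h2 : translate a P = 0 := by
    ext e
    rw [← coeff_expand_zero _ _ e rfl, h]; simp
  apply hP
  rw [← translate_neg_translate a P, h2, map_zero]

/-- The ideal is generated by the `u ^ (M - i) * X ^ i`, and only those with `i ≤ w` contribute to
`X ^ w`. This plays the role of a Hasse derivative of order `w`, which lowers a vanishing order by
at most `w`. -/
theorem pow_dvd_coeff_of_mem_span_pair_pow {R : Type*} [CommRing R] (u : R) (M : ℕ)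
    {f : Polynomial R} (hf : f ∈ Ideal.span {Polynomial.C u, Polynomial.X} ^ M) (w : ℕ) :
    u ^ (M - w) ∣ f.coeff w := by
  induction M generalizing f w with
  | zero => simp
  | succ M ih =>
    rw [pow_succ'] at hf
    refine Submodule.mul_induction_on (C := fun f => u ^ (M + 1 - w) ∣ f.coeff w) hf ?_ ?_
    · intro p hp g hg
      obtain ⟨α, β, rfl⟩ := Ideal.mem_span_pair.1 hp
      have h1 : (α * Polynomial.C u + β * Polynomial.X) * g =
        Polynomial.C u * (α * g) + (β * g) * Polynomial.X := by ring
      rw [h1, Polynomial.coeff_add, Polynomial.coeff_C_mul]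
      refine dvd_add ?_ ?_
      · refine (pow_dvd_pow u (by omega : M + 1 - w ≤ (M - w) + 1)).trans ?_
        rw [pow_succ']
        exact mul_dvd_mul_left u (ih (Ideal.mul_mem_left _ _ hg) w)
      · cases w with
        | zero => simp
        | succ w =>
          rw [Polynomial.coeff_mul_X, Nat.add_sub_add_right]
          exact ih (Ideal.mul_mem_left _ _ hg) w
    · intro x y hx hy
      rw [Polynomial.coeff_add]
      exact dvd_add hx hy

theorem sum_le_natDegree_of_pow_dvd {R : Type*} [CommRing R] [IsDomain R] [Algebra E R]
    (T : Finset E) (k : E → ℕ) {p : Polynomial R} (hp : p ≠ 0)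
    (h : ∀ z ∈ T, (Polynomial.X - Polynomial.C (algebraMap E R z)) ^ k z ∣ p) :
    ∑ z ∈ T, k z ≤ p.natDegree := by
  classical
  have hinj := FaithfulSMul.algebraMap_injective E R
  calc ∑ z ∈ T, k z ≤ ∑ z ∈ T, p.roots.count (algebraMap E R z) := by
        refine Finset.sum_le_sum fun z hz => ?_
        rw [Polynomial.count_roots]
        exact (Polynomial.le_rootMultiplicity_iff hp).2 (h z hz)
    _ = ∑ y ∈ T.map ⟨_, hinj⟩, p.roots.count y := by simp
    _ ≤ Multiset.card p.roots := by
        rw [← Multiset.toFinset_sum_count_eq]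
        refine Finset.sum_le_sum_of_ne_zero fun y _ hy => ?_
        rwa [Multiset.mem_toFinset, ← Multiset.count_ne_zero]
    _ ≤ p.natDegree := Polynomial.card_roots' p

theorem coeff_coeff_swap {R : Type*} [CommRing R] (p : Polynomial (Polynomial R)) (i j : ℕ) :
    ((Polynomial.Bivariate.swap p).coeff i).coeff j = (p.coeff j).coeff i := by
  induction p using Polynomial.induction_on' with
  | add p q hp hq => simp [hp, hq]
  | monomial n f =>
    rw [Polynomial.Bivariate.swap_monomial, ← Polynomial.C_mul_X_pow_eq_monomial,
      Polynomial.coeff_mul_C, Polynomial.coeff_map, Polynomial.coeff_C_mul, Polynomial.coeff_C_mul,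
      Polynomial.coeff_X_pow, Polynomial.coeff_X_pow]
    split_ifs <;> simp

theorem natDegree_coeff_aeval_affine_monomial {B : Type*} [CommRing B] [Algebra E B] (α β : σ → B)
    (e : σ →₀ ℕ) (c : E) :
    (MvPolynomial.aeval (fun i => Polynomial.C (α i) + Polynomial.X * Polynomial.C (β i))
      (MvPolynomial.monomial e c)).natDegree ≤ e.degree ∧
    (MvPolynomial.aeval (fun i => Polynomial.C (α i) + Polynomial.X * Polynomial.C (β i))
      (MvPolynomial.monomial e c)).coeff e.degree = MvPolynomial.aeval β
        (MvPolynomial.monomial e c) := by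
  induction e using Finsupp.induction_linear generalizing c with
  | zero => 
    simp
  | add f g hf hg =>
    have : MvPolynomial.monomial (f + g) c =
        MvPolynomial.monomial f c * MvPolynomial.monomial g 1 := by
      simp [MvPolynomial.monomial_mul]
    rw [this, map_mul, map_add, map_mul]
    exact ⟨Polynomial.natDegree_mul_le_of_le (hf c).1 (hg 1).1, by
      rw [Polynomial.coeff_mul_add_eq_of_natDegree_le (hf c).1 (hg 1).1, (hf c).2, (hg 1).2]⟩
  | single i n =>
    have : (MvPolynomial.monomial (Finsupp.single i n)) c =
        MvPolynomial.C c * MvPolynomial.X i ^ n := by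
      rw [MvPolynomial.X_pow_eq_monomial, MvPolynomial.C_mul_monomial, mul_one]
    set l : Polynomial B := Polynomial.C (α i) + Polynomial.X * Polynomial.C (β i) with hl
    have hd : l.natDegree ≤ 1 := by rw [hl]; compute_degree
    have hc : l.coeff 1 = β i := by simp [hl]
    have hdn : (l ^ n).natDegree ≤ n := by
      simpa using Polynomial.natDegree_pow_le_of_le n hd
    have hcn : (l ^ n).coeff n = β i ^ n := by
      simpa [hc] using Polynomial.coeff_pow_of_natDegree_le hd (m := n)
    rw [this, map_mul, map_pow, MvPolynomial.aeval_X, MvPolynomial.aeval_C,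
      Finsupp.degree_single, map_mul, map_pow, MvPolynomial.aeval_X, MvPolynomial.aeval_C,
      ← hl, Polynomial.algebraMap_apply, Polynomial.coeff_C_mul, hcn]
    exact ⟨(Polynomial.natDegree_C_mul_le _ _).trans hdn, rfl⟩

theorem natDegree_aeval_affine_le {B : Type*} [CommRing B] [Algebra E B] (α β : σ → B)
    (P : MvPolynomial σ E) :
    (MvPolynomial.aeval (fun i => Polynomial.C (α i) + Polynomial.X * Polynomial.C (β i))
      P).natDegree ≤ P.totalDegree := by
  conv_lhs => rw [P.as_sum, map_sum]
  refine Polynomial.natDegree_sum_le_of_forall_le _ _ fun e he => ?_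
  exact (natDegree_coeff_aeval_affine_monomial α β e _).1.trans (MvPolynomial.le_totalDegree he)

theorem coeff_aeval_affine_totalDegree {B : Type*} [CommRing B] [Algebra E B] (α β : σ → B)
    (P : MvPolynomial σ E) :
    (MvPolynomial.aeval (fun i => Polynomial.C (α i) + Polynomial.X * Polynomial.C (β i))
      P).coeff P.totalDegree =
      MvPolynomial.aeval β (MvPolynomial.homogeneousComponent P.totalDegree P) := by
  conv_lhs => enter [1]; rw [P.as_sum, map_sum]
  rw [Polynomial.finsetSum_coeff, MvPolynomial.homogeneousComponent_apply, map_sum,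
    Finset.sum_filter]
  refine Finset.sum_congr rfl fun e he => ?_
  obtain ⟨h1, h2⟩ := natDegree_coeff_aeval_affine_monomial α β e (P.coeff e)
  split_ifs with h
  · rw [← h, h2]
  · refine Polynomial.coeff_eq_zero_of_natDegree_lt (h1.trans_lt ?_)
    exact lt_of_le_of_ne (MvPolynomial.le_totalDegree he) h

end Multiplicity

end Furstenberg

namespace Furstenberg

/-! ### Schwartz-Zippel with multiplicities. -/

section SchwartzZippel

variable {E : Type*} [Field E]

/-- The multiplicity of vanishing at the point `a`, for nonzero polynomials. -/
noncomputable def mult {σ : Type*} (P : MvPolynomial σ E) (a : σ → E) : ℕ :=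
  (expand a P).natTrailingDegree

theorem le_mult_of_mem {σ : Type*} {P : MvPolynomial σ E} (hP : P ≠ 0) {a : σ → E} {M : ℕ}
    (h : P ∈ ptIdeal a ^ M) : M ≤ mult P a := by
  rw [mem_ptIdeal_pow_iff, Polynomial.X_pow_dvd_iff] at h
  exact Polynomial.le_natTrailingDegree (expand_ne_zero a hP) fun m hm => h m hm

theorem mem_ptIdeal_pow_mult {σ : Type*} (P : MvPolynomial σ E) (a : σ → E) :
    P ∈ ptIdeal a ^ mult P a := by
  rw [mem_ptIdeal_pow_iff, Polynomial.X_pow_dvd_iff]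
  exact fun m hm => Polynomial.coeff_eq_zero_of_lt_natTrailingDegree hm

theorem mult_le_totalDegree {σ : Type*} (P : MvPolynomial σ E) (a : σ → E) :
    mult P a ≤ P.totalDegree :=
  (Polynomial.natTrailingDegree_le_natDegree _).trans (natDegree_aeval_affine_le _ _ P)

/-- The point `(X, a + s Y)` over `E[Y][X][s]`. -/
noncomputable def axisHom {d : ℕ} (a : Fin d → E) : MvPolynomial (Fin (d + 1)) E →ₐ[E]
    Polynomial (Polynomial (MvPolynomial (Fin d) E)) :=
  MvPolynomial.aeval (Fin.cons (Polynomial.C Polynomial.X) fun i =>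
    Polynomial.C (Polynomial.C (MvPolynomial.C (a i))) +
      Polynomial.X * Polynomial.C (Polynomial.C (MvPolynomial.X i)) :
    Fin (d + 1) → Polynomial (Polynomial (MvPolynomial (Fin d) E)))

theorem swap_axisHom {d : ℕ} (a : Fin d → E) (P : MvPolynomial (Fin (d + 1)) E) :
    Polynomial.Bivariate.swap (axisHom a P) =
      (MvPolynomial.finSuccEquiv E d P).map (expand a).toRingHom := by
  have h : (Polynomial.Bivariate.swap (R := MvPolynomial (Fin d) E)).toRingEquiv.toRingHom.comp
      (axisHom a).toRingHom = (Polynomial.mapRingHom (expand a).toRingHom).comp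
        (MvPolynomial.finSuccEquiv E d).toRingEquiv.toRingHom := by
    refine MvPolynomial.ringHom_ext (fun c => ?_) fun i => ?_
    · have h1 : axisHom a (MvPolynomial.C c) = Polynomial.C (Polynomial.C (MvPolynomial.C c)) :=
        (axisHom a).commutes c
      have h2 : MvPolynomial.finSuccEquiv E d (MvPolynomial.C c) =
        Polynomial.C (MvPolynomial.C c) := (MvPolynomial.finSuccEquiv E d).commutes c
      have h3 : expand a (MvPolynomial.C c) = Polynomial.C (MvPolynomial.C c) :=
        (expand a).commutes c
      simp [h1, h2, h3, Polynomial.Bivariate.swap_C_C]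
    · refine Fin.cases ?_ (fun i => ?_) i
      · simp [axisHom, Polynomial.Bivariate.swap_X, MvPolynomial.finSuccEquiv_X_zero]
      · simp [axisHom, expand, MvPolynomial.finSuccEquiv_X_succ,
        Polynomial.Bivariate.swap_C_C, Polynomial.Bivariate.swap_Y]
  exact DFunLike.congr_fun h P

/-- On the lines over `a` parallel to the first axis, the multiplicities are controlled by that of
the leading coefficient in the first variable. -/
theorem sum_mult_cons_le [Fintype E] {d : ℕ} {P : MvPolynomial (Fin (d + 1)) E} (hP : P ≠ 0)
    (a : Fin d → E) :
    ∑ z : E, mult P (Fin.cons z a) ≤ (MvPolynomial.finSuccEquiv E d P).natDegree +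
      Fintype.card E * mult (MvPolynomial.finSuccEquiv E d P).leadingCoeff a := by
  set G := MvPolynomial.finSuccEquiv E d P with hG
  have hG0 : G ≠ 0 := by simpa [hG] using hP
  set w := mult G.leadingCoeff a with hw
  have hswap : ∀ i j, ((axisHom a P).coeff i).coeff j = (expand a (G.coeff j)).coeff i := by
    intro i j
    rw [← coeff_coeff_swap, swap_axisHom, Polynomial.coeff_map]
    rfl
  set p := (axisHom a P).coeff w with hp
  have hdeg : p.natDegree ≤ G.natDegree := by
    rw [Polynomial.natDegree_le_iff_coeff_eq_zero]
    intro N hN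
    rw [hswap, Polynomial.coeff_eq_zero_of_natDegree_lt hN]; simp
  -- The coefficient of degree `G.natDegree` is the trailing coefficient of the expansion of
  -- `G.leadingCoeff` at `a`; this is why `w` is that multiplicity.
  have hp0 : p ≠ 0 := by
    intro h0
    have : p.coeff G.natDegree = 0 := by rw [h0]; simp
    rw [hswap] at this
    have h2 := Polynomial.trailingCoeff_nonzero_iff_nonzero.2
      (expand_ne_zero a (Polynomial.leadingCoeff_ne_zero.2 hG0))
    exact h2 this
  have key := sum_le_natDegree_of_pow_dvd (E := E) Finset.univ
    (fun z => mult P (Fin.cons z a) - w) hp0 (fun z _ => ?_)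
  · calc ∑ z : E, mult P (Fin.cons z a) ≤ ∑ z : E, ((mult P (Fin.cons z a) - w) + w) :=
          Finset.sum_le_sum fun z _ => by omega
      _ = ∑ z : E, (mult P (Fin.cons z a) - w) + Fintype.card E * w := by
          rw [Finset.sum_add_distrib]; simp
      _ ≤ _ := by gcongr; exact key.trans hdeg
  · refine pow_dvd_coeff_of_mem_span_pair_pow _ _
      (map_mem_pow_of_mem_ptIdeal_pow (axisHom a) (fun i => ?_) (mem_ptIdeal_pow_mult P (Fin.cons z a))) w
    rw [Ideal.mem_span_pair]
    refine Fin.cases ?_ (fun i => ?_) i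
    · refine ⟨1, 0, ?_⟩
      simp [axisHom]
    · refine ⟨0, Polynomial.C (Polynomial.C (MvPolynomial.X i)), ?_⟩
      rw [eq_sub_iff_add_eq', axisHom, MvPolynomial.aeval_X, Fin.cons_succ, Fin.cons_succ, zero_mul,
        zero_add, mul_comm]
      rfl

/-- The Schwartz-Zippel lemma with multiplicities. -/
theorem card_mul_sum_mult_le [Fintype E] {d : ℕ} {P : MvPolynomial (Fin d) E} (hP : P ≠ 0) :
    Fintype.card E * ∑ a : Fin d → E, mult P a ≤ P.totalDegree * Fintype.card E ^ d := by
  -- The factor `Fintype.card E` on the left avoids the exponent `d - 1`, so the induction can start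
  -- at `d = 0`.
  induction d with
  | zero =>
    have h : ∀ a, mult P a = 0 := fun a => by
      have := mult_le_totalDegree P a
      rw [MvPolynomial.eq_C_of_isEmpty P] at this ⊢
      simpa using this
    simp [h]
  | succ d ih =>
    set G := MvPolynomial.finSuccEquiv E d P with hG
    have hG0 : G ≠ 0 := by simpa [hG] using hP
    have hlc := Polynomial.leadingCoeff_ne_zero.2 hG0
    have hdeg := MvPolynomial.totalDegree_coeff_finSuccEquiv_add_le P G.natDegree hlc
    have hih := ih hlc
    have hsum : ∑ a : Fin (d + 1) → E, mult P a =
        ∑ a : Fin d → E, ∑ z : E, mult P (Fin.cons z a) := by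
      rw [Finset.sum_comm, ← Fintype.sum_prod_type']
      exact (Fintype.sum_equiv (Fin.consEquiv fun _ => E) _ _ fun _ => rfl).symm
    calc Fintype.card E * ∑ a, mult P a
        ≤ Fintype.card E * ∑ a : Fin d → E,
            (G.natDegree + Fintype.card E * mult G.leadingCoeff a) := by
          rw [hsum]
          gcongr
          exact sum_mult_cons_le hP _
      _ = G.natDegree * Fintype.card E ^ (d + 1) +
            Fintype.card E * (Fintype.card E * ∑ a, mult G.leadingCoeff a) := by
          rw [Finset.sum_add_distrib, ← Finset.mul_sum]
          simp
          ring
      _ ≤ G.natDegree * Fintype.card E ^ (d + 1) +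
            Fintype.card E * (G.leadingCoeff.totalDegree * Fintype.card E ^ d) := by
          exact Nat.add_le_add_left (Nat.mul_le_mul_left _ hih) _
      _ = (G.leadingCoeff.totalDegree + G.natDegree) * Fintype.card E ^ (d + 1) := by ring
      _ ≤ _ := by gcongr; exact hdeg

end SchwartzZippel

/-! ### Restriction to a line and the top homogeneous component. -/

section Line

variable {E : Type*} [Field E] {σ : Type*}

/-- The generic point `a + X b + s Y` over `E[Y][X][s]`. -/
noncomputable def lineHom (a b : σ → E) : MvPolynomial σ E →ₐ[E]
    Polynomial (Polynomial (MvPolynomial σ E)) :=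
  MvPolynomial.aeval fun i =>
    Polynomial.C (Polynomial.C (MvPolynomial.C (a i)) +
      Polynomial.X * Polynomial.C (MvPolynomial.C (b i))) +
    Polynomial.X * Polynomial.C (Polynomial.C (MvPolynomial.X i))

/-- The generic point `a + X (b + s Y)` over `E[Y][s][X]`. -/
noncomputable def scaledLineHom (a b : σ → E) : MvPolynomial σ E →ₐ[E]
    Polynomial (Polynomial (MvPolynomial σ E)) :=
  MvPolynomial.aeval fun i => Polynomial.C (Polynomial.C (MvPolynomial.C (a i))) +
    Polynomial.X * Polynomial.C (Polynomial.C (MvPolynomial.C (b i)) +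
      Polynomial.X * Polynomial.C (MvPolynomial.X i))

/-- Replacing `s` by `X s` turns `a + X b + s Y` into `a + X (b + s Y)`, whose top coefficient in
`X` is the top form of `P` at `b + s Y`. -/
theorem swap_scaledLineHom (a b : σ → E) (P : MvPolynomial σ E) :
    Polynomial.Bivariate.swap (scaledLineHom a b P) =
      (lineHom a b P).comp (Polynomial.C Polynomial.X * Polynomial.X) := by
  have h : (Polynomial.Bivariate.swap (R := MvPolynomial σ E)).toRingEquiv.toRingHom.comp
      (scaledLineHom a b).toRingHom =
        (Polynomial.compRingHom (Polynomial.C Polynomial.X * Polynomial.X)).comp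
          (lineHom a b).toRingHom := by
    refine MvPolynomial.ringHom_ext (fun c => ?_) fun i => ?_
    · have h1 : lineHom a b (MvPolynomial.C c) = Polynomial.C (Polynomial.C (MvPolynomial.C c)) :=
        (lineHom a b).commutes c
      have h2 : scaledLineHom a b (MvPolynomial.C c) =
        Polynomial.C (Polynomial.C (MvPolynomial.C c)) := (scaledLineHom a b).commutes c
      simp [h1, h2, Polynomial.Bivariate.swap_C_C]
    · simp [lineHom, scaledLineHom, Polynomial.Bivariate.swap_C_C, Polynomial.Bivariate.swap_X,
        Polynomial.Bivariate.swap_Y]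
      ring
  exact DFunLike.congr_fun h P

theorem natDegree_scaledLineHom_le (a b : σ → E) (P : MvPolynomial σ E) :
    (scaledLineHom a b P).natDegree ≤ P.totalDegree :=
  natDegree_aeval_affine_le (fun i => Polynomial.C (MvPolynomial.C (a i)))
    (fun i => Polynomial.C (MvPolynomial.C (b i)) + Polynomial.X * Polynomial.C (MvPolynomial.X i))
    P

/-- If `P` vanishes to order `M` at many points of a line in direction `b`, then the top
homogeneous component of `P` vanishes at `b` to a high order. -/
theorem coeff_expand_homogeneousComponent_eq_zero {P : MvPolynomial σ E} {a b : σ → E}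
    {T : Finset E} {M w : ℕ} (hT : ∀ t ∈ T, P ∈ ptIdeal (a + t • b) ^ M)
    (hw : w ≤ P.totalDegree) (hlt : P.totalDegree - w < T.card * (M - w)) :
    (expand b (MvPolynomial.homogeneousComponent P.totalDegree P)).coeff w = 0 := by
  -- The substitution sends `X ^ j * s ^ w` to `X ^ (j + w) * s ^ w`; hence the degree bound
  -- `P.totalDegree - w` below.
  have hcoeff : ∀ j, ((lineHom a b P).coeff w).coeff j =
      ((scaledLineHom a b P).coeff (j + w)).coeff w := by
    intro j
    rw [← coeff_coeff_swap (scaledLineHom a b P), swap_scaledLineHom, Polynomial.comp_C_mul_X_coeff,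
      Polynomial.coeff_mul_X_pow]
  set p := (lineHom a b P).coeff w with hp
  have htop : p.coeff (P.totalDegree - w) =
      (expand b (MvPolynomial.homogeneousComponent P.totalDegree P)).coeff w := by
    rw [hcoeff, Nat.sub_add_cancel hw]
    rw [scaledLineHom, coeff_aeval_affine_totalDegree
      (fun i => Polynomial.C (MvPolynomial.C (a i)))
      (fun i => Polynomial.C (MvPolynomial.C (b i)) + Polynomial.X * Polynomial.C (MvPolynomial.X i))
      P]
    rfl
  by_contra hne
  have hp0 : p ≠ 0 := by
    intro h0
    rw [← htop, h0] at hne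
    simp at hne
  have hdeg : p.natDegree ≤ P.totalDegree - w := by
    rw [Polynomial.natDegree_le_iff_coeff_eq_zero]
    intro N hN
    have hN' : P.totalDegree < N + w := by omega
    rw [hcoeff, Polynomial.coeff_eq_zero_of_natDegree_lt
      ((natDegree_scaledLineHom_le a b P).trans_lt hN'), Polynomial.coeff_zero]
  have key := sum_le_natDegree_of_pow_dvd (E := E) T (fun _ => M - w) hp0 (fun t ht => ?_)
  · rw [Finset.sum_const, smul_eq_mul] at key
    omega
  · refine pow_dvd_coeff_of_mem_span_pair_pow _ _
      (map_mem_pow_of_mem_ptIdeal_pow (lineHom a b) (fun i => ?_) (hT t ht)) w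
    rw [Ideal.mem_span_pair]
    refine ⟨Polynomial.C (Polynomial.C (MvPolynomial.C (b i))),
      Polynomial.C (Polynomial.C (MvPolynomial.X i)), ?_⟩
    rw [eq_sub_iff_add_eq']
    have h1 : algebraMap E (Polynomial (Polynomial (MvPolynomial σ E))) ((a + t • b) i) =
        Polynomial.C (Polynomial.C
          (MvPolynomial.C (a i) + MvPolynomial.C t * MvPolynomial.C (b i))) := by
      rw [← map_mul, ← map_add]; rfl
    have h2 : algebraMap E (MvPolynomial σ E) t = MvPolynomial.C t := rfl
    rw [h1, h2, lineHom, MvPolynomial.aeval_X]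
    simp only [map_add, map_mul, map_sub]
    ring

end Line

end Furstenberg

namespace Furstenberg

/-! ### Counting monomials and interpolation. -/

section Count

/-- The exponents in `d` variables of total degree less than `n`. -/
noncomputable def degreeLT (d n : ℕ) : Finset (Fin d →₀ ℕ) :=
  (Finset.range n).biUnion fun j => Finset.finsuppAntidiag Finset.univ j

theorem mem_degreeLT {d n : ℕ} {e : Fin d →₀ ℕ} : e ∈ degreeLT d n ↔ e.degree < n := by
  simp [degreeLT, Finset.mem_finsuppAntidiag, Finsupp.degree_eq_sum]

theorem card_degreeLT_succ (d n : ℕ) : (degreeLT d (n + 1)).card = (n + d).choose d := by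
  rw [degreeLT, Finset.card_biUnion]
  · simp only [Finset.card_finsuppAntidiag_nat_eq_multichoose, Finset.card_univ, Fintype.card_fin]
    rw [Nat.sum_range_multichoose]
  · intro i _ j _ hij
    rw [Function.onFun, Finset.disjoint_left]
    intro e hi hj
    rw [Finset.mem_finsuppAntidiag] at hi hj
    exact hij (hi.1.symm.trans hj.1)

theorem pow_le_card_degreeLT_mul {d : ℕ} (hd : 0 < d) (n : ℕ) :
    (n : ℝ) ^ d ≤ (degreeLT d n).card * (d.factorial : ℝ) := by
  cases n with
  | zero => simp [degreeLT, hd.ne']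
  | succ n =>
    rw [card_degreeLT_succ]
    have := Nat.pow_le_choose (α := ℝ) d (n + d)
    rw [div_le_iff₀ (by positivity)] at this
    rwa [show n + d + 1 - d = n + 1 by omega] at this

theorem card_degreeLT_mul_le (d n : ℕ) :
    (degreeLT d n).card * (d.factorial : ℝ) ≤ (n + d : ℝ) ^ d := by
  cases n with
  | zero => simp [degreeLT]
  | succ n =>
    rw [card_degreeLT_succ]
    have := Nat.choose_le_pow_div (α := ℝ) d (n + d)
    rw [le_div_iff₀ (by positivity)] at this
    refine this.trans ?_
    push_cast
    gcongr
    simp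

/-- Interpolation: a nonzero polynomial of small degree with prescribed vanishing orders. -/
theorem exists_ne_zero_mem_ptIdeal_pow {E : Type*} [Field E] {d n M : ℕ}
    (K : Finset (Fin d → E)) (h : K.card * (degreeLT d M).card < (degreeLT d n).card) :
    ∃ P : MvPolynomial (Fin d) E, P ≠ 0 ∧ P.totalDegree < n ∧ ∀ a ∈ K, P ∈ ptIdeal a ^ M := by
  classical
  let toPoly : (degreeLT d n → E) →ₗ[E] MvPolynomial (Fin d) E :=
    ∑ i : degreeLT d n, (MvPolynomial.monomial i.1).comp (LinearMap.proj i)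
  have hcoeff : ∀ c (i : degreeLT d n), (toPoly c).coeff i.1 = c i := by
    intro c i
    simp [toPoly, MvPolynomial.coeff_sum, MvPolynomial.coeff_monomial]
  -- The conditions: at each point of `K`, the Taylor coefficients of degree below `M`.
  let L : (degreeLT d n → E) →ₗ[E] (K × degreeLT d M → E) :=
    LinearMap.pi fun ae => (MvPolynomial.lcoeff E ae.2.1).comp
      ((translate ae.1.1).toLinearMap.comp toPoly)
  have hker : LinearMap.ker L ≠ ⊥ := by
    apply LinearMap.ker_ne_bot_of_finrank_lt
    simpa using h
  obtain ⟨c, hc, hc0⟩ := Submodule.exists_mem_ne_zero_of_ne_bot hker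
  have hP : toPoly c ≠ 0 := by
    intro h0
    apply hc0
    ext i
    rw [← hcoeff c i, h0]
    simp
  refine ⟨toPoly c, hP, ?_, fun a ha => ?_⟩
  · obtain ⟨e, he, hdeg⟩ := (toPoly c).support.exists_mem_eq_sup
      (MvPolynomial.support_nonempty.2 hP) fun s => s.sum fun _ e => e
    rw [MvPolynomial.totalDegree, hdeg]
    by_contra hn
    rw [MvPolynomial.mem_support_iff] at he
    apply he
    simp only [toPoly, LinearMap.sum_apply, MvPolynomial.coeff_sum, LinearMap.comp_apply,
      MvPolynomial.coeff_monomial]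
    refine Finset.sum_eq_zero fun i _ => if_neg ?_
    rintro rfl
    exact hn (mem_degreeLT.1 i.2)
  · rw [mem_ptIdeal_pow_iff_translate, MvPolynomial.mem_pow_idealOfVars_iff']
    intro e he
    exact congr_fun (LinearMap.mem_ker.1 hc) (⟨a, ha⟩, ⟨e, mem_degreeLT.2 he⟩)

end Count

/-! ### Sets with a rich line in every direction. -/

section Lines

variable {E : Type*} [Field E]

theorem homogeneousComponent_totalDegree_ne_zero {σ : Type*} {P : MvPolynomial σ E} (hP : P ≠ 0) :
    MvPolynomial.homogeneousComponent P.totalDegree P ≠ 0 := by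
  obtain ⟨e, he, hdeg⟩ := P.support.exists_mem_eq_sup
    (MvPolynomial.support_nonempty.2 hP) fun s => s.sum fun _ e => e
  intro h
  have h1 := MvPolynomial.coeff_homogeneousComponent (φ := P) P.totalDegree e
  rw [h, if_pos (show e.degree = P.totalDegree from hdeg.symm)] at h1
  exact MvPolynomial.mem_support_iff.1 he (by simpa using h1.symm)

theorem homogeneousComponent_mem_ptIdeal_zero_pow {σ : Type*} (P : MvPolynomial σ E) {l n : ℕ}
    (hl : l ≤ n) : MvPolynomial.homogeneousComponent n P ∈ ptIdeal 0 ^ l := by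
  classical
  have h0 : ptIdeal 0 = MvPolynomial.idealOfVars σ E := by simp [ptIdeal]
  rw [h0, MvPolynomial.mem_pow_idealOfVars_iff']
  intro e he
  rw [MvPolynomial.coeff_homogeneousComponent, if_neg (by omega)]

/-- The effective form of the bound for sets with many points on a line in every direction. -/
theorem pow_le_card_mul_pow [Fintype E] {d m : ℕ} (hd : 0 < d) (hm : 0 < m)
    (hmq : m ≤ Fintype.card E) (K : Finset (Fin d → E))
    (hK : ∀ b : Fin d → E, b ≠ 0 → ∃ (a : Fin d → E) (T : Finset E), m ≤ T.card ∧
      ∀ t ∈ T, a + t • b ∈ K) (r : ℕ) :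
    (m * r * Fintype.card E : ℝ) ^ d ≤ K.card * (2 * Fintype.card E * r + d : ℝ) ^ d := by
  set Q := Fintype.card E with hQ
  by_contra! hlt
  have hcount : K.card * (degreeLT d (2 * Q * r)).card < (degreeLT d (m * r * Q)).card := by
    have h1 := pow_le_card_degreeLT_mul hd (m * r * Q)
    have h2 := card_degreeLT_mul_le d (2 * Q * r)
    have hf : (0 : ℝ) < d.factorial := by positivity
    push_cast at h1 h2
    have h3 : (K.card * (degreeLT d (2 * Q * r)).card : ℝ) * d.factorial <
        (degreeLT d (m * r * Q)).card * d.factorial := by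
      calc _ = (K.card : ℝ) * ((degreeLT d (2 * Q * r)).card * d.factorial) := by ring
        _ ≤ (K.card : ℝ) * (2 * Q * r + d : ℝ) ^ d := by gcongr
        _ < _ := hlt
        _ ≤ _ := h1
    exact_mod_cast lt_of_mul_lt_mul_right h3 hf.le
  obtain ⟨P, hP, hdeg, hvan⟩ := exists_ne_zero_mem_ptIdeal_pow K hcount
  set H := MvPolynomial.homogeneousComponent P.totalDegree P with hH
  have hH0 : H ≠ 0 := homogeneousComponent_totalDegree_ne_zero hP
  have hHdeg : H.totalDegree ≤ P.totalDegree :=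
    (MvPolynomial.homogeneousComponent_isHomogeneous _ _).totalDegree_le
  have hmr : m * r ≤ 2 * Q * r := by nlinarith
  -- `K` is nonempty, and a nonzero polynomial cannot vanish to order above its degree.
  have hrP : 2 * Q * r ≤ P.totalDegree := by
    have : Nonempty (Fin d) := ⟨⟨0, hd⟩⟩
    obtain ⟨a, T, hT, hline⟩ := hK 1 one_ne_zero
    obtain ⟨t, ht⟩ := Finset.card_pos.1 (hm.trans_le hT)
    exact (le_mult_of_mem hP (hvan _ (hline t ht))).trans (mult_le_totalDegree P _)
  have hmult : ∀ b, m * r ≤ mult H b := by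
    intro b
    refine le_mult_of_mem hH0 ?_
    -- No line has direction 0, but a form vanishes at 0 to the order of its degree.
    by_cases hb : b = 0
    · rw [hb]
      exact homogeneousComponent_mem_ptIdeal_zero_pow P (hmr.trans hrP)
    · obtain ⟨a, T, hT, hline⟩ := hK b hb
      rw [mem_ptIdeal_pow_iff, Polynomial.X_pow_dvd_iff]
      intro w hw
      refine coeff_expand_homogeneousComponent_eq_zero (a := a) (T := T) (M := 2 * Q * r)
        (fun t ht => hvan _ (hline t ht)) (by omega) ?_
      have h1 : m * (2 * Q * r - w) ≤ T.card * (2 * Q * r - w) := Nat.mul_le_mul_right _ hT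
      -- The order `2 Q r` is chosen here: `w < m r ≤ Q r` leaves order at least `Q r` at each of
      -- `m` points, more zeros in all than the degree of `P` permits.
      have h2 : m * r * Q ≤ m * (2 * Q * r - w) := by
        have : r * Q ≤ 2 * Q * r - w := by
          have : m * r ≤ Q * r := Nat.mul_le_mul_right _ hmq
          have : 2 * Q * r = Q * r + Q * r := by ring
          rw [mul_comm r Q]
          omega
        rw [mul_assoc]
        exact Nat.mul_le_mul_left _ this
      omega
  have hsz := card_mul_sum_mult_le hH0
  have hQpos : 0 < Q := Fintype.card_pos
  have h1 : Q ^ d * (m * r) ≤ ∑ b : Fin d → E, mult H b := by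
    calc Q ^ d * (m * r) = ∑ _b : Fin d → E, m * r := by simp [hQ]
      _ ≤ _ := Finset.sum_le_sum fun b _ => hmult b
  have h2 : (m * r * Q) * Q ^ d ≤ P.totalDegree * Q ^ d := by
    calc (m * r * Q) * Q ^ d = Q * (Q ^ d * (m * r)) := by ring
      _ ≤ Q * ∑ b : Fin d → E, mult H b := Nat.mul_le_mul_left _ h1
      _ ≤ H.totalDegree * Q ^ d := hsz
      _ ≤ _ := Nat.mul_le_mul_right _ hHdeg
  have := Nat.le_of_mul_le_mul_right h2 (by positivity)
  omega

/-- Dividing the effective bound by `(r Q) ^ d` turns the error `d` into `d / (Q r)`, which tends to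
0. -/
theorem pow_le_card_mul_two_pow [Fintype E] {d m : ℕ} (hd : 0 < d) (hm : 0 < m)
    (hmq : m ≤ Fintype.card E) (K : Finset (Fin d → E))
    (hK : ∀ b : Fin d → E, b ≠ 0 → ∃ (a : Fin d → E) (T : Finset E), m ≤ T.card ∧
      ∀ t ∈ T, a + t • b ∈ K) :
    (m : ℝ) ^ d ≤ K.card * (2 : ℝ) ^ d := by
  have hQ : (0 : ℝ) < Fintype.card E := by exact_mod_cast Fintype.card_pos
  have hlim : Filter.Tendsto
      (fun r : ℕ => (K.card : ℝ) * (2 + (d / Fintype.card E : ℝ) / (r : ℝ)) ^ d) Filter.atTop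
      (nhds (K.card * (2 + 0 : ℝ) ^ d)) :=
    ((tendsto_const_nhds.add (tendsto_const_div_atTop_nhds_zero_nat _)).pow d).const_mul _
  rw [add_zero] at hlim
  refine ge_of_tendsto hlim ?_
  filter_upwards [Filter.eventually_gt_atTop 0] with r hr
  have hr' : (0 : ℝ) < r := by exact_mod_cast hr
  have h := pow_le_card_mul_pow hd hm hmq K hK r
  have hpos : (0 : ℝ) < (r * Fintype.card E : ℝ) ^ d := by positivity
  refine le_of_mul_le_mul_right ?_ hpos
  rw [mul_assoc, ← mul_pow, ← mul_pow]
  have h1 : (m : ℝ) * (r * Fintype.card E) = m * r * Fintype.card E := by ring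
  have h2 : (2 + (d / Fintype.card E : ℝ) / r) * (r * Fintype.card E) =
      2 * Fintype.card E * r + d := by
    field_simp
  rwa [h1, h2]

end Lines

/-! ### Passing to the extension field. -/

section Transfer

/-- Furstenberg sets for `k`-spaces over `F` have many points on a line in every direction over an
extension of degree `k`. -/
theorem pow_le_card_mul_two_pow_of_isFurstenberg {F E : Type*} [Field F] [Field E] [Fintype E]
    [Algebra F E] {n d k m : ℕ} (hE : Module.finrank F E = k) (hd : 0 < d) (hn : n = d * k)
    (hm : 0 < m) (hmq : m ≤ Fintype.card E) {S : Finset (Fin n → F)} (hS : IsFurstenberg k m S) :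
    (m : ℝ) ^ d ≤ S.card * (2 : ℝ) ^ d := by
  classical
  have : Module.Finite F E := Module.Finite.of_finite
  have hfin : Module.finrank F (Fin n → F) = Module.finrank F (Fin d → E) := by
    rw [Module.finrank_fin_fun, Module.finrank_pi_fintype]
    simp [hE, hn]
  let φ : (Fin n → F) ≃ₗ[F] (Fin d → E) := LinearEquiv.ofFinrankEq _ _ hfin
  have := pow_le_card_mul_two_pow hd hm hmq (S.map φ.toEquiv.toEmbedding) (fun b hb => ?_)
  · simpa using this
  -- The range of `ι` corresponds to the line `E b`, so a rich translate of it is a rich line in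
  -- direction `b`.
  · let ι : E →ₗ[F] (Fin n → F) :=
      φ.symm.toLinearMap.comp ((LinearMap.toSpanSingleton E (Fin d → E) b).restrictScalars F)
    have hι : Function.Injective ι :=
      φ.symm.injective.comp (smul_left_injective E hb)
    obtain ⟨v, hv⟩ := hS (LinearMap.range ι) (by rw [LinearMap.finrank_range_of_inj hι, hE])
    refine ⟨φ v, Finset.univ.filter fun t => v + ι t ∈ S, ?_, ?_⟩
    · refine hv.trans ?_
      have hsub : ((v +ᵥ (LinearMap.range ι : Set (Fin n → F))) ∩ (S : Set (Fin n → F))) ⊆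
          ((Finset.univ.filter fun t => v + ι t ∈ S).image fun t => v + ι t :
            Finset (Fin n → F)) := by
        rintro _ ⟨⟨_, ⟨t, rfl⟩, rfl⟩, hx⟩
        simp only [Finset.coe_image, Set.mem_image]
        exact ⟨t, by simpa using hx, rfl⟩
      refine (Set.ncard_le_ncard hsub (Finset.finite_toSet _)).trans ?_
      rw [Set.ncard_coe_finset]
      exact Finset.card_image_le
    · intro t ht
      rw [Finset.mem_filter] at ht
      refine Finset.mem_map.2 ⟨_, ht.2, ?_⟩
      simp [ι]

end Transfer

end Furstenberg

theorem mainTheorem7 (F : Type*) [Field F] [Finite F] (q n k m : ℕ) (hq : Nat.card F = q)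
    (hn : 0 < n) (hk : 0 < k) (hm : 0 < m) (hmq : m ≤ q ^ k) (hkn : k ∣ n) :
    (1 / 2 ^ (n / k) : ℝ) * (m : ℝ) ^ (n / k) ≤ (furstenbergNumber F n k m : ℝ) := by
  subst hq
  obtain ⟨S, hS, hcard⟩ := exists_isFurstenberg_card_eq F n k m hmq
  obtain ⟨p, hp⟩ := CharP.exists F
  have : Fact p.Prime := ⟨CharP.char_is_prime F p⟩
  have : NeZero k := ⟨hk.ne'⟩
  let := Fintype.ofFinite (FiniteField.Extension F p k)
  have hcardE : Fintype.card (FiniteField.Extension F p k) = Nat.card F ^ k := by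
    rw [Fintype.card_eq_nat_card, FiniteField.natCard_extension]
  have h := Furstenberg.pow_le_card_mul_two_pow_of_isFurstenberg
    (FiniteField.finrank_extension F p k) (Nat.div_pos (Nat.le_of_dvd hn hkn) hk)
    (Nat.div_mul_cancel hkn).symm hm (hmq.trans_eq hcardE.symm) hS
  rw [← hcard, one_div, inv_mul_le_iff₀ (by positivity), mul_comm]
  exact h
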